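/- Let $H$ be a real Hilbert space and let $f:H\to(-\infty,+\infty]$ be proper, convex and lower semicontinuous with $\Omega:=\operatorname{Argmin} f\neq\varnothing$. Let $\rho>0$ and $\operatorname{prox}_{\rho f}(u)=\arg\min_{x}\{\frac1{2\rho}\|x-u\|^2+f(x)\}$. Given $z^{-1},z^0\in H$, real sequences $(\alpha_k)_{k\ge0}$, $(\lambda_k)_{k\ge0}$ and errors $(e^k)_{k\ge0}$ in $H$, let $$\mu^k=z^k+\alpha_k(z^k-z^{k-1}),\qquad z^{k+1}=\mu^k+\lambda_k\big(\operatorname{prox}_{\rho f}\mu^k+e^k-\mu^k\big),\qquad k\ge 0 .$$ Assume that one of the following two sets of conditions holds. (I) For all $k\ge0$, $0\le\alpha_k\le\alpha<1$ and $0<\lambda\le\lambda_k\le\lambda'<2$; $\sum_{k\ge0}\alpha_k\|z^{k+1}-z^k\|^2<+\infty$ and $\sum_{k\ge0}\lambda_k\|e^k\|<+\infty$; $(z^k)$ is bounded. In this case put $\theta=\lambda'$. (II) For all $k\ge0$, $0\le\alpha_k\le\alpha<1$; $\alpha_0=0$ and $(\alpha_k)$ is nondecreasing; there are $\lambda,\sigma,\delta>0$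 with $$\delta>\frac{\alpha[\alpha(1+\alpha)+\sigma]}{1-\alpha^2},\qquad \lambda\le\lambda_k\le\overline\lambda:=2\,\frac{\delta-\alpha[\alpha(1+\alpha)+\alpha\delta+\sigma]}{\delta[1+\alpha(1+\alpha)+\alpha\delta+\sigma]}\quad\text{for all }k\ge0;$$ $(z^k)$ is bounded and $\sum_{k\ge0}\|e^k\|<+\infty$. In this case put $\theta=\overline\lambda$. Then: (i) $\lim_{k\to\infty}\|z^k-z^*\|$ exists for every $z^*\in\Omega$. (ii) $(z^k)$ converges weakly to a point of $\Omega$, that is, to a minimizer of $f$. (iii) For every $z^*\in\Omega$ and every $k\ge1$, $$\min_{1\le i\le k}\|\operatorname{prox}_{\rho f}\mu^i-\mu^i\|^2\le\frac{1}{k\,\lambda\,(2-\theta)}\big(\|z^1-z^*\|^2+\Delta\big),$$ where $$\Delta=\alpha\sum_{k\ge1}\big[\|z^k-z^*\|^2-\|z^{k-1}-z^*\|^2\big]_+ +\sum_{k\ge1}2\|z^{k+1}-z^*\|\,\lambda_k\|e^k\|+\sum_{k\ge1}\alpha_k(1+\alpha_k)\|z^k-z^{k-1}\|^2,$$ and these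 three series converge, so that $\Delta<+\infty$; here $[m]_+=\max\{m,0\}$. -/

import Mathlib

namespace InertialProx

/-- `f : H → (-∞, +∞]` is proper, convex and lower semicontinuous. -/
structure IsProperConvexLsc {H : Type*} [NormedAddCommGroup H] [InnerProductSpace ℝ H]
    (f : H → EReal) : Prop where
  ne_bot : ∀ x, f x ≠ ⊥
  proper : ∃ x, f x ≠ ⊤
  convex : ∀ x y : H, ∀ a b : ℝ, 0 < a → 0 < b → a + b = 1 →
    f (a • x + b • y) ≤ (a : EReal) * f x + (b : EReal) * f y
  lsc : LowerSemicontinuous f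

/-- The set of global minimizers of `f`. -/
def Argmin {H : Type*} (f : H → EReal) : Set H :=
  {x | ∀ y, f x ≤ f y}

/-- `prox_{ρ f}(u)`: the minimizer of `x ↦ ‖x - u‖² / (2ρ) + f x`. -/
noncomputable def prox {H : Type*} [NormedAddCommGroup H] [InnerProductSpace ℝ H]
    (f : H → EReal) (ρ : ℝ) (u : H) : H :=
  Classical.epsilon fun p : H =>
    p ∈ Argmin fun x : H => ((1 / (2 * ρ) * ‖x - u‖ ^ 2 : ℝ) : EReal) + f x

/-- The sequences `z⁰, z¹, …` and `μ⁰, μ¹, …` are generated by the inexact inertial proximal point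
algorithm from the starting points `z⁻¹ = zInit` and `z⁰`. -/
structure IsGenerated {H : Type*} [NormedAddCommGroup H] [InnerProductSpace ℝ H]
    (f : H → EReal) (ρ : ℝ) (α lam : ℕ → ℝ) (e : ℕ → H) (zInit : H) (z μ : ℕ → H) : Prop where
  mu_zero : μ 0 = z 0 + α 0 • (z 0 - zInit)
  mu_succ : ∀ k, μ (k + 1) = z (k + 1) + α (k + 1) • (z (k + 1) - z k)
  z_succ : ∀ k, z (k + 1) = μ k + lam k • (prox f ρ (μ k) + e k - μ k)

/-- First set of conditions; `a`, `l`, `l'` are the constants bounding `α_k` and `λ_k`. -/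
structure ConditionsI {H : Type*} [NormedAddCommGroup H] [InnerProductSpace ℝ H]
    (α lam : ℕ → ℝ) (e z : ℕ → H) (a l l' : ℝ) : Prop where
  alpha_mem : ∀ k, 0 ≤ α k ∧ α k ≤ a
  a_lt_one : a < 1
  l_pos : 0 < l
  lam_mem : ∀ k, l ≤ lam k ∧ lam k ≤ l'
  l'_lt_two : l' < 2
  summable_inertia : Summable fun k => α k * ‖z (k + 1) - z k‖ ^ 2
  summable_error : Summable fun k => lam k * ‖e k‖
  bounded : Bornology.IsBounded (Set.range z)

/-- The upper bound on the relaxation parameters in the second set of conditions. -/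
noncomputable def lamBar (a σ δ : ℝ) : ℝ :=
  2 * ((δ - a * (a * (1 + a) + a * δ + σ)) / (δ * (1 + a * (1 + a) + a * δ + σ)))

/-- Second set of conditions. -/
structure ConditionsII {H : Type*} [NormedAddCommGroup H] [InnerProductSpace ℝ H]
    (α lam : ℕ → ℝ) (e z : ℕ → H) (a l σ δ : ℝ) : Prop where
  alpha_mem : ∀ k, 0 ≤ α k ∧ α k ≤ a
  a_lt_one : a < 1
  alpha_zero : α 0 = 0
  alpha_mono : Monotone α
  l_pos : 0 < l
  σ_pos : 0 < σ
  δ_pos : 0 < δ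
  δ_gt : a * (a * (1 + a) + σ) / (1 - a ^ 2) < δ
  lam_mem : ∀ k, l ≤ lam k ∧ lam k ≤ lamBar a σ δ
  bounded : Bornology.IsBounded (Set.range z)
  summable_error : Summable fun k => ‖e k‖

/-- `[‖z^k - z*‖² - ‖z^{k-1} - z*‖²]₊` for the index `k = j + 1 ≥ 1`. -/
noncomputable def incTerm {H : Type*} [NormedAddCommGroup H] (z : ℕ → H) (zs : H) (j : ℕ) : ℝ :=
  max (‖z (j + 1) - zs‖ ^ 2 - ‖z j - zs‖ ^ 2) 0

/-- `δ_k λ_k ‖e^k‖` with `δ_k = 2 ‖z^{k+1} - z*‖`, for the index `k = j + 1 ≥ 1`. -/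
noncomputable def errTerm {H : Type*} [NormedAddCommGroup H] (lam : ℕ → ℝ) (e z : ℕ → H) (zs : H)
    (j : ℕ) : ℝ :=
  2 * ‖z (j + 2) - zs‖ * lam (j + 1) * ‖e (j + 1)‖

/-- `ρ_k ‖z^k - z^{k-1}‖²` with `ρ_k = α_k (1 + α_k)`, for the index `k = j + 1 ≥ 1`. -/
noncomputable def inertiaTerm {H : Type*} [NormedAddCommGroup H] (α : ℕ → ℝ) (z : ℕ → H)
    (j : ℕ) : ℝ :=
  α (j + 1) * (1 + α (j + 1)) * ‖z (j + 1) - z j‖ ^ 2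

/-- The constant `Δ` of the rate; the theorem asserts separately that its series converge. -/
noncomputable def Delta {H : Type*} [NormedAddCommGroup H] (α lam : ℕ → ℝ) (e z : ℕ → H) (a : ℝ)
    (zs : H) : ℝ :=
  a * (∑' j, incTerm z zs j) + (∑' j, errTerm lam e z zs j) + ∑' j, inertiaTerm α z j

end InertialProx

/-!
`prox f ρ` is firmly nonexpansive and its fixed points are the minimizers of `f`. Firm
nonexpansiveness makes `‖z k - s‖ ^ 2` decrease at each step, up to the terms of `Delta`, by a
multiple of the squared residual `‖prox f ρ (μ k) - μ k‖ ^ 2`. Once the squared increments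
`‖z (k + 1) - z k‖ ^ 2` are summable, these terms are summable too, so the distances to the
minimizers converge and the residuals vanish; Opial's lemma and demiclosedness then give weak
convergence, and averaging the decrease gives the rate.

Both sets of conditions make the squared increments summable through a Lyapunov function. Under
the first it is the Moreau envelope plus a multiple of the last squared increment: `x - prox f ρ x`
is the gradient of `ρ` times the envelope, so a relaxed step is an inexact gradient step with a
heavy-ball term. Under the second it is
`‖z (k + 1) - s‖ ^ 2 - α (k + 1) * ‖z k - s‖ ^ 2 + Γ * ‖z (k + 1) - z k‖ ^ 2` with
`Γ = a * (1 + a) + a * δ`, and `lam k ≤ lamBar a σ δ` is exactly the condition on the coefficients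
under which the estimate leaves a decrease of `σ * ‖z (k + 2) - z (k + 1)‖ ^ 2`.
-/

namespace InertialProx

open Filter Topology
open scoped RealInnerProductSpace

section RealSequences

lemma sum_range_le_of_add_le_add {u b s : ℕ → ℝ} (h : ∀ k, u (k + 1) + b k ≤ u k + s k) (n : ℕ) :
    ∑ k ∈ Finset.range n, b k ≤ u 0 - u n + ∑ k ∈ Finset.range n, s k := by
  induction n with
  | zero => simp
  | succ n ih =>
    rw [Finset.sum_range_succ, Finset.sum_range_succ]
    linarith [h n]

lemma summable_of_add_le_add {u b s : ℕ → ℝ} (hu : BddBelow (Set.range u)) (hb : ∀ k, 0 ≤ b k)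
    (hs : Summable s) (h : ∀ k, u (k + 1) + b k ≤ u k + s k) : Summable b := by
  obtain ⟨c, hc⟩ := hu
  obtain ⟨S, hS⟩ := hs.hasSum.tendsto_sum_nat.bddAbove_range
  refine summable_of_sum_range_le hb (c := u 0 - c + S) fun n => ?_
  have hcn : c ≤ u n := hc ⟨n, rfl⟩
  have hSn : ∑ k ∈ Finset.range n, s k ≤ S := hS ⟨n, rfl⟩
  linarith [sum_range_le_of_add_le_add h n]

lemma summable_of_le_mul_add {t s : ℕ → ℝ} {a : ℝ} (ha : a < 1) (ht : ∀ k, 0 ≤ t k)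
    (hs : Summable s) (h : ∀ k, t (k + 1) ≤ a * t k + s k) : Summable t := by
  have hgap : 0 < 1 - a := sub_pos.mpr ha
  have hbdd : BddBelow (Set.range t) := ⟨0, Set.forall_mem_range.mpr ht⟩
  refine (summable_mul_left_iff hgap.ne').mp (summable_of_add_le_add hbdd
    (fun k => mul_nonneg hgap.le (ht k)) hs fun k => ?_)
  linarith [h k]

lemma exists_tendsto_of_summable_max_sub {u : ℕ → ℝ} (hu : BddBelow (Set.range u))
    (h : Summable fun k => max (u (k + 1) - u k) 0) : ∃ d, Tendsto u atTop (𝓝 d) := by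
  set S : ℕ → ℝ := fun n => ∑ k ∈ Finset.range n, max (u (k + 1) - u k) 0 with hS
  have hanti : Antitone fun n => u n - S n := antitone_nat_of_succ_le fun n => by
    simp only [hS, Finset.sum_range_succ]
    linarith [le_max_left (u (n + 1) - u n) 0]
  have hbdd : BddBelow (Set.range fun n => u n - S n) := by
    obtain ⟨c, hc⟩ := hu
    refine ⟨c - ∑' k, max (u (k + 1) - u k) 0, ?_⟩
    rintro _ ⟨n, rfl⟩
    exact sub_le_sub (hc ⟨n, rfl⟩) (h.sum_le_tsum _ fun k _ => le_max_right _ _)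
  exact ⟨_, ((tendsto_atTop_ciInf hanti hbdd).add h.hasSum.tendsto_sum_nat).congr fun n =>
    sub_add_cancel _ _⟩

lemma inf'_le_sum_div_card {ι : Type*} {s : Finset ι} (hs : s.Nonempty) (g : ι → ℝ) :
    s.inf' hs g ≤ (∑ i ∈ s, g i) / s.card := by
  rw [le_div_iff₀' (by exact_mod_cast hs.card_pos), ← nsmul_eq_mul]
  exact s.card_nsmul_le_sum g _ fun i hi => Finset.inf'_le g hi

end RealSequences

section WeakConvergence

variable {H : Type*} [NormedAddCommGroup H] [InnerProductSpace ℝ H]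

lemma tendsto_inner_of_tendsto_toWeakSpace {ι : Type*} {F : Filter ι} {z : ι → H} {x : H}
    (h : Tendsto (fun k => toWeakSpace ℝ H (z k)) F (𝓝 (toWeakSpace ℝ H x))) (y : H) :
    Tendsto (fun k => ⟪y, z k⟫) F (𝓝 ⟪y, x⟫) :=
  ((WeakBilin.eval_continuous (topDualPairing ℝ H).flip (innerSL ℝ y)).tendsto _).comp h

lemma inclusionInDoubleDual_surjective [CompleteSpace H] :
    Function.Surjective (NormedSpace.inclusionInDoubleDual ℝ H) := by
  intro ψ
  refine ⟨(InnerProductSpace.toDual ℝ H).symm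
    (ψ.comp (InnerProductSpace.toDual ℝ H).toContinuousLinearEquiv.toContinuousLinearMap), ?_⟩
  ext g
  obtain ⟨y, rfl⟩ := (InnerProductSpace.toDual ℝ H).surjective g
  rw [NormedSpace.dual_def, InnerProductSpace.toDual_apply_apply, real_inner_comm,
    InnerProductSpace.toDual_symm_apply]
  rfl

lemma isCompact_closure_toWeakSpace_image [CompleteSpace H] {S : Set H}
    (hS : Bornology.IsBounded S) : IsCompact (closure (toWeakSpace ℝ H '' S)) := by
  refine NormedSpace.isCompact_closure_of_isBounded ℝ H _
    (by rwa [Set.preimage_image_eq _ (toWeakSpace ℝ H).injective]) fun ψ _ => ?_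
  obtain ⟨x, hx⟩ := inclusionInDoubleDual_surjective (WeakDual.toStrongDual ψ)
  exact ⟨toWeakSpace ℝ H x, hx⟩

lemma exists_tendsto_inner_sub {z : ℕ → H} {x y : H} {d d' : ℝ}
    (hx : Tendsto (fun k => ‖z k - x‖) atTop (𝓝 d))
    (hy : Tendsto (fun k => ‖z k - y‖) atTop (𝓝 d')) :
    ∃ c, Tendsto (fun k => ⟪x - y, z k⟫) atTop (𝓝 c) := by
  refine ⟨_, ((((hy.pow 2).sub (hx.pow 2)).add_const (‖x‖ ^ 2 - ‖y‖ ^ 2)).div_const 2).congr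
    fun k => ?_⟩
  rw [norm_sub_sq_real, norm_sub_sq_real, inner_sub_left, real_inner_comm x, real_inner_comm y]
  ring

lemma eq_of_mapClusterPt_of_tendsto_norm_sub {z : ℕ → H} {x y : H} {d d' : ℝ}
    (hx : MapClusterPt (toWeakSpace ℝ H x) atTop fun k => toWeakSpace ℝ H (z k))
    (hy : MapClusterPt (toWeakSpace ℝ H y) atTop fun k => toWeakSpace ℝ H (z k))
    (hd : Tendsto (fun k => ‖z k - x‖) atTop (𝓝 d))
    (hd' : Tendsto (fun k => ‖z k - y‖) atTop (𝓝 d')) : x = y := by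
  obtain ⟨c, hc⟩ := exists_tendsto_inner_sub hd hd'
  have heq : ∀ w, MapClusterPt (toWeakSpace ℝ H w) atTop (fun k => toWeakSpace ℝ H (z k)) →
      ⟪x - y, w⟫ = c := fun w hw => by
    obtain ⟨U, hU, hzU⟩ := mapClusterPt_iff_ultrafilter.mp hw
    exact tendsto_nhds_unique (tendsto_inner_of_tendsto_toWeakSpace hzU _) (hc.mono_left hU)
  rw [← sub_eq_zero, ← inner_self_eq_zero (𝕜 := ℝ), inner_sub_right, heq x hx, heq y hy, sub_self]

/-- **Opial's lemma**. -/
lemma exists_tendsto_toWeakSpace_of_mapClusterPt [CompleteSpace H] {z : ℕ → H} {S : Set H}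
    (hS : S.Nonempty) (hlim : ∀ s ∈ S, ∃ d, Tendsto (fun k => ‖z k - s‖) atTop (𝓝 d))
    (hclu : ∀ x, MapClusterPt (toWeakSpace ℝ H x) atTop (fun k => toWeakSpace ℝ H (z k)) →
      x ∈ S) :
    ∃ s ∈ S, Tendsto (fun k => toWeakSpace ℝ H (z k)) atTop (𝓝 (toWeakSpace ℝ H s)) := by
  have hbdd : Bornology.IsBounded (Set.range z) := by
    obtain ⟨s, hs⟩ := hS
    obtain ⟨d, hd⟩ := hlim s hs
    obtain ⟨C, hC⟩ := hd.bddAbove_range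
    refine (Metric.isBounded_closedBall (x := s) (r := C)).subset ?_
    rintro _ ⟨k, rfl⟩
    exact mem_closedBall_iff_norm.mpr (hC ⟨k, rfl⟩)
  have hcompact := isCompact_closure_toWeakSpace_image hbdd
  have hmem : ∀ᶠ k in atTop, toWeakSpace ℝ H (z k) ∈ closure (toWeakSpace ℝ H '' Set.range z) :=
    Eventually.of_forall fun k => subset_closure ⟨z k, ⟨k, rfl⟩, rfl⟩
  obtain ⟨s, -, hs⟩ := hcompact.exists_mapClusterPt_of_frequently hmem.frequently
  refine ⟨s, hclu s hs, hcompact.tendsto_nhds_of_unique_mapClusterPt hmem fun x _ hx => ?_⟩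
  obtain ⟨d, hd⟩ := hlim s (hclu s hs)
  obtain ⟨d', hd'⟩ := hlim x (hclu x hx)
  exact eq_of_mapClusterPt_of_tendsto_norm_sub (z := z) hx hs hd' hd

end WeakConvergence

section FirmlyNonexpansive

lemma norm_residual_sub_le {E : Type*} [SeminormedAddCommGroup E] {P : E → E}
    (hP : LipschitzWith 1 P) (x y : E) :
    ‖(x - P x) - (y - P y)‖ ≤ 2 * ‖x - y‖ := by
  have hle := hP.dist_le_mul x y
  rw [NNReal.coe_one, one_mul, dist_eq_norm, dist_eq_norm] at hle
  rw [sub_sub_sub_comm]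
  linarith [norm_sub_le (x - y) (P x - P y)]

variable {H : Type*} [NormedAddCommGroup H] [InnerProductSpace ℝ H] {P : H → H}

/-- Firm nonexpansiveness of a map of a Hilbert space: the property of resolvents, in particular of
proximal maps, that governs the contraction of the relaxed iteration. -/
def IsFirmlyNonexpansive (P : H → H) : Prop :=
  ∀ x y, ‖P x - P y‖ ^ 2 ≤ ⟪P x - P y, x - y⟫

lemma IsFirmlyNonexpansive.lipschitzWith (hP : IsFirmlyNonexpansive P) : LipschitzWith 1 P := by
  refine LipschitzWith.of_dist_le_mul fun x y => ?_
  rw [dist_eq_norm, dist_eq_norm, NNReal.coe_one, one_mul]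
  rcases (norm_nonneg (P x - P y)).eq_or_lt with h | h
  · exact h ▸ norm_nonneg _
  · refine le_of_mul_le_mul_left ?_ h
    rw [← sq]
    exact (hP x y).trans (real_inner_le_norm _ _)

lemma IsFirmlyNonexpansive.norm_sub_sq_le_inner (hP : IsFirmlyNonexpansive P) {s : H}
    (hs : P s = s) (x : H) : ‖x - P x‖ ^ 2 ≤ ⟪x - P x, x - s⟫ := by
  have h := hP x s
  rw [hs] at h
  rw [← sub_sub_sub_cancel_right x (P x) s, norm_sub_sq_real, inner_sub_left (x - s),
    real_inner_self_eq_norm_sq, real_inner_comm (P x - s) (x - s)]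
  linarith

/-- The demiclosedness principle of Browder. -/
lemma eq_of_tendsto_toWeakSpace_of_tendsto_residual (hP : LipschitzWith 1 P) {ι : Type*}
    {F : Filter ι} [F.NeBot] {z : ι → H} {x : H} (hz : Bornology.IsBounded (Set.range z))
    (hweak : Tendsto (fun k => toWeakSpace ℝ H (z k)) F (𝓝 (toWeakSpace ℝ H x)))
    (hres : Tendsto (fun k => ‖z k - P (z k)‖) F (𝓝 0)) : P x = x := by
  obtain ⟨C, hC⟩ := isBounded_iff_forall_norm_le.mp hz
  have hnonexp : ∀ k, ‖x - P x‖ ^ 2 ≤ ‖z k - P (z k)‖ ^ 2 + 2 * ‖z k - P (z k)‖ * (C + ‖x‖)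
      - 2 * ⟪x - P x, z k - x⟫ := by
    intro k
    have hdist := hP.dist_le_mul (z k) x
    rw [NNReal.coe_one, one_mul, dist_eq_norm, dist_eq_norm] at hdist
    have htri : ‖z k - P x‖ ≤ ‖z k - P (z k)‖ + ‖z k - x‖ :=
      (norm_sub_le_norm_sub_add_norm_sub _ (P (z k)) _).trans (add_le_add_right hdist _)
    have hsq := pow_le_pow_left₀ (norm_nonneg _) htri 2
    have hexp : ‖z k - P x‖ ^ 2 = ‖z k - x‖ ^ 2 + 2 * ⟪x - P x, z k - x⟫ + ‖x - P x‖ ^ 2 := by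
      rw [← sub_add_sub_cancel (z k) x (P x), norm_add_sq_real, real_inner_comm]
    have hbound : ‖z k - x‖ ≤ C + ‖x‖ :=
      (norm_sub_le _ _).trans (add_le_add_left (hC _ ⟨k, rfl⟩) _)
    linarith [mul_le_mul_of_nonneg_left hbound (norm_nonneg (z k - P (z k)))]
  have hinner : Tendsto (fun k => ⟪x - P x, z k - x⟫) F (𝓝 0) := by
    simpa [inner_sub_right] using
      (tendsto_inner_of_tendsto_toWeakSpace hweak (x - P x)).sub_const ⟪x - P x, x⟫
  have hlim := ((hres.pow 2).add ((hres.const_mul 2).mul_const (C + ‖x‖))).sub (hinner.const_mul 2)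
  have hle : ‖x - P x‖ ^ 2 ≤ 0 := by
    simpa using ge_of_tendsto hlim (Eventually.of_forall hnonexp)
  have hzero : ‖x - P x‖ = 0 := pow_eq_zero_iff two_ne_zero |>.mp (le_antisymm hle (sq_nonneg _))
  exact (norm_sub_eq_zero_iff.mp hzero).symm

end FirmlyNonexpansive

section InertialStep

variable {H : Type*} [NormedAddCommGroup H] [InnerProductSpace ℝ H] {P : H → H}
  {s x₀ x₁ x₂ m e : H} {t lam : ℝ}

lemma IsFirmlyNonexpansive.norm_relaxed_step_sub_sq_le (hP : IsFirmlyNonexpansive P)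
    (hs : P s = s) (hlam : 0 ≤ lam) (hx₂ : x₂ = m + lam • (P m + e - m)) :
    ‖x₂ - s‖ ^ 2 + lam * (2 - lam) * ‖P m - m‖ ^ 2 ≤
      ‖m - s‖ ^ 2 + 2 * ‖x₂ - s‖ * lam * ‖e‖ := by
  have hfix := mul_le_mul_of_nonneg_left (hP.norm_sub_sq_le_inner hs m) hlam
  have hcs := mul_le_mul_of_nonneg_left (real_inner_le_norm (x₂ - s) e) hlam
  have hexact : ‖(x₂ - s) - lam • e‖ ^ 2 = ‖(m - s) - lam • (m - P m)‖ ^ 2 := by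
    rw [hx₂]
    congr 2
    module
  simp only [norm_sub_sq_real (x₂ - s), norm_sub_sq_real (m - s), norm_smul, inner_smul_right,
    Real.norm_eq_abs, mul_pow, sq_abs, real_inner_comm (m - P m) (m - s)] at hexact
  rw [norm_sub_rev (P m) m]
  linarith [mul_nonneg (sq_nonneg lam) (sq_nonneg ‖e‖)]

lemma norm_extrapolate_sub_sq (x₀ x₁ s : H) (t : ℝ) :
    ‖x₁ + t • (x₁ - x₀) - s‖ ^ 2
      = ‖x₁ - s‖ ^ 2 + t * (‖x₁ - s‖ ^ 2 - ‖x₀ - s‖ ^ 2) + t * (1 + t) * ‖x₁ - x₀‖ ^ 2 := by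
  have hx₀ : x₀ - s = (x₁ - s) - (x₁ - x₀) := by abel
  rw [add_sub_right_comm, hx₀, norm_add_sq_real, norm_sub_sq_real (x₁ - s), norm_smul,
    real_inner_smul_right, Real.norm_eq_abs, mul_pow, sq_abs]
  ring

lemma IsFirmlyNonexpansive.inertial_step_le (hP : IsFirmlyNonexpansive P) (hs : P s = s)
    (hlam : 0 ≤ lam) (hm : m = x₁ + t • (x₁ - x₀)) (hx₂ : x₂ = m + lam • (P m + e - m)) :
    ‖x₂ - s‖ ^ 2 + lam * (2 - lam) * ‖P m - m‖ ^ 2 ≤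
      ‖x₁ - s‖ ^ 2 + t * (‖x₁ - s‖ ^ 2 - ‖x₀ - s‖ ^ 2) + 2 * ‖x₂ - s‖ * lam * ‖e‖
        + t * (1 + t) * ‖x₁ - x₀‖ ^ 2 := by
  have hrelax := hP.norm_relaxed_step_sub_sq_le hs hlam hx₂
  rw [hm, norm_extrapolate_sub_sq, ← hm] at hrelax
  linarith

lemma residual_eq_of_relaxed_step (hlam : lam ≠ 0) (hm : m = x₁ + t • (x₁ - x₀))
    (hx₂ : x₂ = m + lam • (P m + e - m)) :
    m - P m = lam⁻¹ • (t • (x₁ - x₀) - (x₂ - x₁)) + e := by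
  have hstep : t • (x₁ - x₀) - (x₂ - x₁) = lam • (m - P m - e) := by
    rw [eq_sub_of_add_eq' hm.symm, hx₂]
    module
  rw [hstep, inv_smul_smul₀ hlam, sub_add_cancel]

end InertialStep

section ResidualPotential

variable {H : Type*} [NormedAddCommGroup H] [InnerProductSpace ℝ H] {P : H → H} {E : H → ℝ}
  {x₀ x₁ x₂ m e : H} {t lam : ℝ}

/-- The descent inequality of a function `E` whose gradient is the `1`-Lipschitz field `x - P x`,
stated without differentiability. The Moreau envelope has this property for the proximal map. -/
def IsResidualPotential (P : H → H) (E : H → ℝ) : Prop :=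
  ∀ x m, E x ≤ E m + ⟪m - P m, x - m⟫ + 1 / 2 * ‖x - m‖ ^ 2

lemma IsResidualPotential.inertial_step_le (hE : IsResidualPotential P E)
    (hP : LipschitzWith 1 P) (ht : 0 ≤ t) (hlam : 0 < lam) (hm : m = x₁ + t • (x₁ - x₀))
    (hx₂ : x₂ = m + lam • (P m + e - m)) :
    E x₂ + (1 / lam - 1 / 2) * ‖x₂ - x₁‖ ^ 2 ≤
      E x₁ + (1 / lam + 2) * (t * (‖x₁ - x₀‖ * ‖x₂ - x₁‖)) + ‖e‖ * ‖x₂ - x₁‖ := by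
  have hdesc := hE x₂ x₁
  have hdist : ‖x₁ - m‖ = t * ‖x₁ - x₀‖ := by
    rw [hm, sub_add_cancel_left, norm_neg, norm_smul, Real.norm_of_nonneg ht]
  have hdiff : ⟪(x₁ - P x₁) - (m - P m), x₂ - x₁⟫ ≤ 2 * (t * ‖x₁ - x₀‖) * ‖x₂ - x₁‖ :=
    (real_inner_le_norm _ _).trans
      (mul_le_mul_of_nonneg_right (hdist ▸ norm_residual_sub_le hP x₁ m) (norm_nonneg _))
  have hres : ⟪m - P m, x₂ - x₁⟫ ≤ 1 / lam * (t * (‖x₁ - x₀‖ * ‖x₂ - x₁‖) - ‖x₂ - x₁‖ ^ 2)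
      + ‖e‖ * ‖x₂ - x₁‖ := by
    rw [residual_eq_of_relaxed_step hlam.ne' hm hx₂, inner_add_left, real_inner_smul_left,
      inner_sub_left, real_inner_smul_left, real_inner_self_eq_norm_sq, one_div]
    gcongr <;> exact real_inner_le_norm _ _
  rw [inner_sub_left] at hdiff
  linarith

lemma mul_mul_le_half_sq_add {c K p q : ℝ} (hc : 0 < c) (ht : 0 ≤ t) (ht1 : t ≤ 1) :
    K * (t * (p * q)) ≤ c / 2 * p ^ 2 + K ^ 2 / (2 * c) * (t * q ^ 2) := by
  have ht2 : K ^ 2 / (2 * c) * (t ^ 2 * q ^ 2) ≤ K ^ 2 / (2 * c) * (t * q ^ 2) := by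
    gcongr
    exact pow_le_of_le_one ht ht1 two_ne_zero
  have hsq : c / 2 * p ^ 2 + K ^ 2 / (2 * c) * (t ^ 2 * q ^ 2) - K * (t * (p * q))
      = (c * p - K * (t * q)) ^ 2 / (2 * c) := by
    field_simp
    ring
  have : 0 ≤ (c * p - K * (t * q)) ^ 2 / (2 * c) := by positivity
  linarith

lemma IsResidualPotential.lyapunov_step_le {c K : ℝ} (hE : IsResidualPotential P E)
    (hP : LipschitzWith 1 P) (ht : 0 ≤ t) (ht1 : t ≤ 1) (hlam : 0 < lam) (hc : 0 < c)
    (hclam : c ≤ 1 / lam - 1 / 2) (hK : 1 / lam + 2 ≤ K) (hm : m = x₁ + t • (x₁ - x₀))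
    (hx₂ : x₂ = m + lam • (P m + e - m)) :
    E x₂ + c / 2 * ‖x₂ - x₁‖ ^ 2 + c / 2 * ‖x₂ - x₁‖ ^ 2 ≤
      E x₁ + c / 2 * ‖x₁ - x₀‖ ^ 2
        + (K ^ 2 / (2 * c) * (t * ‖x₂ - x₁‖ ^ 2) + ‖e‖ * ‖x₂ - x₁‖) := by
  have hstep := hE.inertial_step_le hP ht hlam hm hx₂
  have hcoef := mul_le_mul_of_nonneg_right hclam (sq_nonneg ‖x₂ - x₁‖)
  have hcross : (1 / lam + 2) * (t * (‖x₁ - x₀‖ * ‖x₂ - x₁‖)) ≤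
      K * (t * (‖x₁ - x₀‖ * ‖x₂ - x₁‖)) := by gcongr
  have hamgm := mul_mul_le_half_sq_add (K := K) (p := ‖x₁ - x₀‖) (q := ‖x₂ - x₁‖) hc ht ht1
  linarith

end ResidualPotential

section MonotoneInertia

variable {H : Type*} [NormedAddCommGroup H] [InnerProductSpace ℝ H] {P : H → H}
  {s x₀ x₁ x₂ m e : H} {t lam a σ δ : ℝ}

lemma mul_norm_sq_le_norm_smul_sub (ht : 0 ≤ t) (η : ℝ) (u v : H) :
    η * ‖v‖ ^ 2 ≤ (t + η) * (‖t • u - v‖ ^ 2 + t * η * ‖u‖ ^ 2) := by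
  have hsq : (t + η) * (‖t • u - v‖ ^ 2 + t * η * ‖u‖ ^ 2) - η * ‖v‖ ^ 2
      = t * ‖(t + η) • u - v‖ ^ 2 := by
    simp only [norm_sub_sq_real, norm_smul, real_inner_smul_left, mul_pow, Real.norm_eq_abs, sq_abs]
    ring
  exact sub_nonneg.mp (hsq ▸ mul_nonneg ht (sq_nonneg _))

lemma mul_norm_sq_le_of_relaxation_le {A : ℝ} (ht : 0 ≤ t) (hta : t ≤ a) (hδ : 0 < δ)
    (hlam : 0 < lam) (hlam2 : lam ≤ 2) (hA : 0 ≤ A)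
    (h : (a + δ * (lam / 2)) * A ≤ (1 - lam / 2) * δ) (u v : H) :
    A * ‖v‖ ^ 2 ≤ (2 - lam) / lam * ‖t • u - v‖ ^ 2 + t * δ * (1 - lam / 2) * ‖u‖ ^ 2 := by
  have hη : 0 < t + δ * (lam / 2) := by positivity
  have hcoef : 0 ≤ (2 - lam) / lam := div_nonneg (sub_nonneg.mpr hlam2) hlam.le
  have hyoung := mul_le_mul_of_nonneg_left (mul_norm_sq_le_norm_smul_sub ht (δ * (lam / 2)) u v)
    hcoef
  refine le_of_mul_le_mul_left ?_ hη
  calc (t + δ * (lam / 2)) * (A * ‖v‖ ^ 2)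
      ≤ (a + δ * (lam / 2)) * A * ‖v‖ ^ 2 := by
        rw [← mul_assoc]
        gcongr
    _ ≤ (1 - lam / 2) * δ * ‖v‖ ^ 2 := by gcongr
    _ = (2 - lam) / lam * (δ * (lam / 2) * ‖v‖ ^ 2) := by
        field_simp
    _ ≤ _ := hyoung
    _ = _ := by
        field_simp

lemma sub_le_mul_norm_residual_sq (hlam : 0 < lam) (hlam2 : lam ≤ 2)
    (hm : m = x₁ + t • (x₁ - x₀)) (hx₂ : x₂ = m + lam • (P m + e - m)) :
    (2 - lam) / lam * ‖t • (x₁ - x₀) - (x₂ - x₁)‖ ^ 2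
        - 2 * (2 - lam) * ‖t • (x₁ - x₀) - (x₂ - x₁)‖ * ‖e‖ ≤
      lam * (2 - lam) * ‖P m - m‖ ^ 2 := by
  set w := t • (x₁ - x₀) - (x₂ - x₁) with hw
  have hgap : 0 ≤ 2 - lam := sub_nonneg.mpr hlam2
  have hres : lam * (2 - lam) * ‖P m - m‖ ^ 2 = (2 - lam) / lam * ‖w‖ ^ 2
      + 2 * (2 - lam) * ⟪w, e⟫ + lam * (2 - lam) * ‖e‖ ^ 2 := by
    rw [norm_sub_rev, residual_eq_of_relaxed_step hlam.ne' hm hx₂, ← hw, norm_add_sq_real,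
      norm_smul, real_inner_smul_left, mul_pow, Real.norm_eq_abs, sq_abs]
    field_simp
  have hcs := mul_le_mul_of_nonneg_left (neg_le_of_abs_le (abs_real_inner_le_norm w e))
    (mul_nonneg zero_le_two hgap)
  have herr : 0 ≤ lam * (2 - lam) * ‖e‖ ^ 2 := by positivity
  linarith

lemma IsFirmlyNonexpansive.inertial_energy_step_le (hP : IsFirmlyNonexpansive P) (hs : P s = s)
    (ht : 0 ≤ t) (hta : t ≤ a) (hlam : 0 < lam) (hlam2 : lam ≤ 2) (hσ : 0 ≤ σ) (hδ : 0 < δ)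
    (h : (a + δ * (lam / 2)) * (a * (1 + a) + a * δ + σ) ≤ (1 - lam / 2) * δ)
    (hm : m = x₁ + t • (x₁ - x₀)) (hx₂ : x₂ = m + lam • (P m + e - m)) :
    ‖x₂ - s‖ ^ 2 - t * ‖x₁ - s‖ ^ 2 + (a * (1 + a) + a * δ) * ‖x₂ - x₁‖ ^ 2
        + σ * ‖x₂ - x₁‖ ^ 2 ≤
      ‖x₁ - s‖ ^ 2 - t * ‖x₀ - s‖ ^ 2 + (a * (1 + a) + a * δ) * ‖x₁ - x₀‖ ^ 2
        + (2 * (2 - lam) * ‖t • (x₁ - x₀) - (x₂ - x₁)‖ + 2 * lam * ‖x₂ - s‖) * ‖e‖ := by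
  have ha : 0 ≤ a := ht.trans hta
  have hstep := hP.inertial_step_le hs hlam.le hm hx₂
  have hres := sub_le_mul_norm_residual_sq hlam hlam2 hm hx₂
  have hquad := mul_norm_sq_le_of_relaxation_le ht hta hδ hlam hlam2 (by positivity) h
    (x₁ - x₀) (x₂ - x₁)
  have hcoef : t * (1 + t) + t * δ * (1 - lam / 2) ≤ a * (1 + a) + a * δ := by
    have hδt : t * δ * (1 - lam / 2) ≤ a * δ * 1 := by gcongr <;> linarith
    have htt : t * (1 + t) ≤ a * (1 + a) := by gcongr
    linarith
  linarith [mul_le_mul_of_nonneg_right hcoef (sq_nonneg ‖x₁ - x₀‖)]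

lemma energy_error_coeff_le {C : ℝ} (ht : 0 ≤ t) (ht1 : t ≤ 1) (hlam : 0 ≤ lam)
    (hlam2 : lam ≤ 2) (h₁ : ‖x₁ - x₀‖ ≤ C) (h₂ : ‖x₂ - x₁‖ ≤ C) (hs : ‖x₂ - s‖ ≤ C) :
    2 * (2 - lam) * ‖t • (x₁ - x₀) - (x₂ - x₁)‖ + 2 * lam * ‖x₂ - s‖ ≤ 8 * C := by
  have hC : 0 ≤ C := (norm_nonneg _).trans hs
  have : 0 ≤ 2 - lam := sub_nonneg.mpr hlam2
  have hw : ‖t • (x₁ - x₀) - (x₂ - x₁)‖ ≤ 1 * C + C := by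
    refine (norm_sub_le _ _).trans ?_
    rw [norm_smul, Real.norm_of_nonneg ht]
    gcongr
  calc 2 * (2 - lam) * ‖t • (x₁ - x₀) - (x₂ - x₁)‖ + 2 * lam * ‖x₂ - s‖
      ≤ 2 * (2 - lam) * (1 * C + C) + 2 * lam * C := by gcongr
    _ ≤ 8 * C := by linarith [mul_nonneg hlam hC]

end MonotoneInertia

section RateTerms

variable {H : Type*} [NormedAddCommGroup H] {α lam : ℕ → ℝ} {e z : ℕ → H} {a l θ : ℝ}

lemma incTerm_nonneg (z : ℕ → H) (s : H) (j : ℕ) : 0 ≤ incTerm z s j :=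
  le_max_right _ _

lemma exists_tendsto_norm_sub {s : H} (h : Summable (incTerm z s)) :
    ∃ d, Tendsto (fun k => ‖z k - s‖) atTop (𝓝 d) := by
  have hbdd : BddBelow (Set.range fun k => ‖z k - s‖ ^ 2) :=
    ⟨0, Set.forall_mem_range.mpr fun _ => sq_nonneg _⟩
  obtain ⟨d, hd⟩ := exists_tendsto_of_summable_max_sub hbdd h
  exact ⟨√d, hd.sqrt.congr fun k => Real.sqrt_sq (norm_nonneg _)⟩

lemma exists_norm_sub_le_of_isBounded (hz : Bornology.IsBounded (Set.range z)) (s : H) :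
    ∃ C, (∀ k, ‖z k - s‖ ≤ C) ∧ ∀ i j, ‖z i - z j‖ ≤ C := by
  obtain ⟨C, hC⟩ := Metric.isBounded_iff.mp (hz.insert s)
  have hmem (k : ℕ) : z k ∈ insert s (Set.range z) := .inr ⟨k, rfl⟩
  simp only [dist_eq_norm] at hC
  exact ⟨C, fun k => hC (hmem k) (.inl rfl), fun i j => hC (hmem i) (hmem j)⟩

/-- The bounds `0 ≤ α_k ≤ a < 1` and `0 < l ≤ λ_k ≤ θ < 2` that both sets of conditions entail;
`θ` is the constant of that name in the rate. -/
structure AdmissibleParameters (α lam : ℕ → ℝ) (a l θ : ℝ) : Prop where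
  alpha_nonneg : ∀ k, 0 ≤ α k
  alpha_le : ∀ k, α k ≤ a
  a_lt_one : a < 1
  l_pos : 0 < l
  l_le_lam : ∀ k, l ≤ lam k
  lam_le : ∀ k, lam k ≤ θ
  θ_lt_two : θ < 2

namespace AdmissibleParameters

variable (h : AdmissibleParameters α lam a l θ)
include h

lemma a_nonneg : 0 ≤ a :=
  (h.alpha_nonneg 0).trans (h.alpha_le 0)

lemma alpha_le_one (k : ℕ) : α k ≤ 1 :=
  (h.alpha_le k).trans h.a_lt_one.le

lemma lam_pos (k : ℕ) : 0 < lam k :=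
  h.l_pos.trans_le (h.l_le_lam k)

lemma θ_pos : 0 < θ :=
  (h.lam_pos 0).trans_le (h.lam_le 0)

lemma l_mul_pos : 0 < l * (2 - θ) :=
  mul_pos h.l_pos (sub_pos.mpr h.θ_lt_two)

lemma l_mul_le (k : ℕ) : l * (2 - θ) ≤ lam k * (2 - lam k) :=
  mul_le_mul (h.l_le_lam k) (sub_le_sub_left (h.lam_le k) 2) (sub_pos.mpr h.θ_lt_two).le
    (h.lam_pos k).le

lemma inertiaTerm_nonneg (z : ℕ → H) (j : ℕ) : 0 ≤ inertiaTerm α z j := by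
  have := h.alpha_nonneg (j + 1)
  unfold inertiaTerm
  positivity

lemma errTerm_nonneg (e z : ℕ → H) (s : H) (j : ℕ) : 0 ≤ errTerm lam e z s j := by
  have := h.lam_pos (j + 1)
  unfold errTerm
  positivity

lemma summable_inertiaTerm (hinc : Summable fun k => ‖z (k + 1) - z k‖ ^ 2) :
    Summable (inertiaTerm α z) := by
  refine (hinc.mul_left 2).of_nonneg_of_le (h.inertiaTerm_nonneg z) fun j =>
    mul_le_mul_of_nonneg_right ?_ (sq_nonneg _)
  nlinarith [h.alpha_nonneg (j + 1), h.alpha_le_one (j + 1)]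

lemma summable_errTerm (hz : Bornology.IsBounded (Set.range z)) (he : Summable fun k => ‖e k‖)
    (s : H) : Summable (errTerm lam e z s) := by
  obtain ⟨C, hC, -⟩ := exists_norm_sub_le_of_isBounded hz s
  have hC₀ : 0 ≤ C := (norm_nonneg _).trans (hC 0)
  refine (((summable_nat_add_iff 1).mpr he).mul_left (2 * C * θ)).of_nonneg_of_le
    (h.errTerm_nonneg e z s) fun j => ?_
  have := h.lam_pos (j + 1)
  unfold errTerm
  gcongr
  exacts [hC (j + 2), h.lam_le (j + 1)]

end AdmissibleParameters

end RateTerms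

section InertialIteration

variable {H : Type*} [NormedAddCommGroup H] [InnerProductSpace ℝ H] {P : H → H} {s : H}
  {α lam : ℕ → ℝ} {e z μ : ℕ → H} {a l θ : ℝ}

/-- The inexact relaxed inertial iteration of a map `P`. The initial extrapolation `μ 0` is
arbitrary: the energy estimates start at the index `1`. -/
structure IsInertialIteration (P : H → H) (α lam : ℕ → ℝ) (e z μ : ℕ → H) : Prop where
  mu_succ : ∀ k, μ (k + 1) = z (k + 1) + α (k + 1) • (z (k + 1) - z k)
  z_succ : ∀ k, z (k + 1) = μ k + lam k • (P (μ k) + e k - μ k)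

namespace IsInertialIteration

lemma norm_sub_sq_add_residual_le (hit : IsInertialIteration P α lam e z μ)
    (hP : IsFirmlyNonexpansive P) (hs : P s = s) (hpar : AdmissibleParameters α lam a l θ)
    (k : ℕ) :
    ‖z (k + 2) - s‖ ^ 2 + l * (2 - θ) * ‖P (μ (k + 1)) - μ (k + 1)‖ ^ 2 ≤
      ‖z (k + 1) - s‖ ^ 2 + (a * incTerm z s k + errTerm lam e z s k + inertiaTerm α z k) := by
  have hstep := hP.inertial_step_le hs (hpar.lam_pos (k + 1)).le (hit.mu_succ k)
    (hit.z_succ (k + 1))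
  have hres := mul_le_mul_of_nonneg_right (hpar.l_mul_le (k + 1))
    (sq_nonneg ‖P (μ (k + 1)) - μ (k + 1)‖)
  have hinc : α (k + 1) * (‖z (k + 1) - s‖ ^ 2 - ‖z k - s‖ ^ 2) ≤ a * incTerm z s k :=
    (mul_le_mul_of_nonneg_left (le_max_left _ _) (hpar.alpha_nonneg _)).trans
      (mul_le_mul_of_nonneg_right (hpar.alpha_le _) (le_max_right _ _))
  unfold errTerm inertiaTerm
  linarith

lemma summable_incTerm (hit : IsInertialIteration P α lam e z μ) (hP : IsFirmlyNonexpansive P)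
    (hs : P s = s) (hpar : AdmissibleParameters α lam a l θ)
    (herr : Summable (errTerm lam e z s)) (hin : Summable (inertiaTerm α z)) :
    Summable (incTerm z s) := by
  refine summable_of_le_mul_add hpar.a_lt_one (incTerm_nonneg z s) (herr.add hin) fun k => ?_
  have hstep := hit.norm_sub_sq_add_residual_le hP hs hpar k
  have hres := mul_nonneg hpar.l_mul_pos.le (sq_nonneg ‖P (μ (k + 1)) - μ (k + 1)‖)
  have hinc := mul_nonneg hpar.a_nonneg (incTerm_nonneg z s k)
  exact max_le (by linarith)
    (by linarith [hpar.errTerm_nonneg e z s k, hpar.inertiaTerm_nonneg z k])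

lemma sum_residual_le (hit : IsInertialIteration P α lam e z μ) (hP : IsFirmlyNonexpansive P)
    (hs : P s = s) (hpar : AdmissibleParameters α lam a l θ)
    (herr : Summable (errTerm lam e z s)) (hin : Summable (inertiaTerm α z)) (n : ℕ) :
    l * (2 - θ) * ∑ k ∈ Finset.range n, ‖P (μ (k + 1)) - μ (k + 1)‖ ^ 2 ≤
      ‖z 1 - s‖ ^ 2 + Delta α lam e z a s := by
  have hinc := (hit.summable_incTerm hP hs hpar herr hin).mul_left a
  have htsum := ((hinc.add herr).add hin).sum_le_tsum (Finset.range n) fun k _ =>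
    add_nonneg (add_nonneg (mul_nonneg hpar.a_nonneg (incTerm_nonneg z s k))
      (hpar.errTerm_nonneg e z s k)) (hpar.inertiaTerm_nonneg z k)
  rw [(hinc.add herr).tsum_add hin, hinc.tsum_add herr, tsum_mul_left] at htsum
  have htelescope := sum_range_le_of_add_le_add (u := fun k => ‖z (k + 1) - s‖ ^ 2)
    (hit.norm_sub_sq_add_residual_le hP hs hpar) n
  rw [Finset.mul_sum]
  unfold Delta
  linarith [sq_nonneg ‖z (n + 1) - s‖]

lemma inf'_residual_le (hit : IsInertialIteration P α lam e z μ) (hP : IsFirmlyNonexpansive P)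
    (hs : P s = s) (hpar : AdmissibleParameters α lam a l θ)
    (herr : Summable (errTerm lam e z s)) (hin : Summable (inertiaTerm α z)) {k : ℕ}
    (hk : 1 ≤ k) :
    (Finset.Icc 1 k).inf' (Finset.nonempty_Icc.mpr hk) (fun i => ‖P (μ i) - μ i‖ ^ 2) ≤
      1 / (k * l * (2 - θ)) * (‖z 1 - s‖ ^ 2 + Delta α lam e z a s) := by
  have hsum := hit.sum_residual_le hP hs hpar herr hin k
  rw [Finset.range_eq_Ico, Finset.sum_Ico_add' (fun i => ‖P (μ i) - μ i‖ ^ 2), zero_add,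
    Finset.Ico_add_one_right_eq_Icc, ← le_div_iff₀' hpar.l_mul_pos] at hsum
  refine (inf'_le_sum_div_card _ _).trans ?_
  rw [Nat.card_Icc, Nat.add_sub_cancel]
  refine (div_le_div_of_nonneg_right hsum k.cast_nonneg).trans_eq ?_
  rw [div_div, one_div_mul_eq_div, mul_comm, ← mul_assoc]

lemma summable_residual (hit : IsInertialIteration P α lam e z μ) (hP : IsFirmlyNonexpansive P)
    (hs : P s = s) (hpar : AdmissibleParameters α lam a l θ)
    (herr : Summable (errTerm lam e z s)) (hin : Summable (inertiaTerm α z)) :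
    Summable fun k => ‖P (μ (k + 1)) - μ (k + 1)‖ ^ 2 :=
  summable_of_sum_range_le (fun _ => sq_nonneg _) fun n =>
    (le_div_iff₀' hpar.l_mul_pos).mpr (hit.sum_residual_le hP hs hpar herr hin n)

lemma tendsto_residual (hit : IsInertialIteration P α lam e z μ) (hP : LipschitzWith 1 P)
    (hα : ∀ k, 0 ≤ α k) (hα₁ : ∀ k, α k ≤ 1) (hinc : Summable fun k => ‖z (k + 1) - z k‖ ^ 2)
    (hres : Summable fun k => ‖P (μ (k + 1)) - μ (k + 1)‖ ^ 2) :
    Tendsto (fun k => ‖z k - P (z k)‖) atTop (𝓝 0) := by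
  have hinc₀ : Tendsto (fun k => 2 * ‖z (k + 1) - z k‖) atTop (𝓝 0) := by
    simpa using hinc.tendsto_atTop_zero.sqrt.const_mul 2
  have hres₀ : Tendsto (fun k => ‖P (μ (k + 1)) - μ (k + 1)‖) atTop (𝓝 0) := by
    simpa using hres.tendsto_atTop_zero.sqrt
  refine (tendsto_add_atTop_iff_nat 1).mp (squeeze_zero (fun k => norm_nonneg _) (fun k => ?_)
    (by simpa using hinc₀.add hres₀))
  have hdist : ‖z (k + 1) - μ (k + 1)‖ ≤ ‖z (k + 1) - z k‖ := by
    rw [hit.mu_succ k, sub_add_cancel_left, norm_neg, norm_smul, Real.norm_of_nonneg (hα _)]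
    exact mul_le_of_le_one_left (norm_nonneg _) (hα₁ _)
  calc ‖z (k + 1) - P (z (k + 1))‖
      ≤ ‖(z (k + 1) - P (z (k + 1))) - (μ (k + 1) - P (μ (k + 1)))‖
          + ‖μ (k + 1) - P (μ (k + 1))‖ := norm_le_norm_sub_add _ _
    _ ≤ 2 * ‖z (k + 1) - μ (k + 1)‖ + ‖P (μ (k + 1)) - μ (k + 1)‖ :=
        add_le_add (norm_residual_sub_le hP _ _) (norm_sub_rev _ _).le
    _ ≤ 2 * ‖z (k + 1) - z k‖ + ‖P (μ (k + 1)) - μ (k + 1)‖ := by gcongr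

lemma exists_tendsto_toWeakSpace [CompleteSpace H] (hit : IsInertialIteration P α lam e z μ)
    (hP : IsFirmlyNonexpansive P) (hfix : ∃ s, P s = s)
    (hpar : AdmissibleParameters α lam a l θ) (hz : Bornology.IsBounded (Set.range z))
    (he : Summable fun k => ‖e k‖) (hinc : Summable fun k => ‖z (k + 1) - z k‖ ^ 2) :
    ∃ s, P s = s ∧ Tendsto (fun k => toWeakSpace ℝ H (z k)) atTop (𝓝 (toWeakSpace ℝ H s)) := by
  have hin := hpar.summable_inertiaTerm hinc
  have herr := hpar.summable_errTerm hz he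
  obtain ⟨s₀, hs₀⟩ := hfix
  have hres := hit.tendsto_residual hP.lipschitzWith hpar.alpha_nonneg hpar.alpha_le_one hinc
    (hit.summable_residual hP hs₀ hpar (herr s₀) hin)
  refine exists_tendsto_toWeakSpace_of_mapClusterPt (S := {s | P s = s}) ⟨s₀, hs₀⟩
    (fun s hs => exists_tendsto_norm_sub (hit.summable_incTerm hP hs hpar (herr s) hin))
    fun x hx => ?_
  obtain ⟨U, hU, hweak⟩ := mapClusterPt_iff_ultrafilter.mp hx
  exact eq_of_tendsto_toWeakSpace_of_tendsto_residual hP.lipschitzWith hz hweak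
    (hres.mono_left hU)

lemma summable_norm_sub_sq_of_isResidualPotential (hit : IsInertialIteration P α lam e z μ)
    (hP : LipschitzWith 1 P) {E : H → ℝ} (hE : IsResidualPotential P E)
    (hEbdd : BddBelow (Set.range E)) (hpar : AdmissibleParameters α lam a l θ)
    (hz : Bornology.IsBounded (Set.range z)) (he : Summable fun k => ‖e k‖)
    (hinertia : Summable fun k => α k * ‖z (k + 1) - z k‖ ^ 2) :
    Summable fun k => ‖z (k + 1) - z k‖ ^ 2 := by
  have hc : 0 < 1 / θ - 1 / 2 := sub_pos.mpr (one_div_lt_one_div_of_lt hpar.θ_pos hpar.θ_lt_two)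
  set c := 1 / θ - 1 / 2
  set K := 1 / l + 2
  obtain ⟨C, -, hC⟩ := exists_norm_sub_le_of_isBounded hz (z 0)
  obtain ⟨E₀, hE₀⟩ := hEbdd
  have hbdd : BddBelow (Set.range fun k => E (z (k + 1)) + c / 2 * ‖z (k + 1) - z k‖ ^ 2) := by
    refine ⟨E₀, Set.forall_mem_range.mpr fun k => ?_⟩
    exact (hE₀ ⟨_, rfl⟩).trans (le_add_of_nonneg_right (by positivity))
  have hsum := summable_of_add_le_add hbdd
    (b := fun k => c / 2 * ‖z (k + 2) - z (k + 1)‖ ^ 2)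
    (s := fun k => K ^ 2 / (2 * c) * (α (k + 1) * ‖z (k + 2) - z (k + 1)‖ ^ 2)
      + ‖e (k + 1)‖ * C) (fun k => by positivity)
    ((((summable_nat_add_iff 1).mpr hinertia).mul_left _).add
      (((summable_nat_add_iff 1).mpr he).mul_right _)) fun k => ?_
  · exact (summable_nat_add_iff 1).mp ((summable_mul_left_iff (half_pos hc).ne').mp hsum)
  have hclam : c ≤ 1 / lam (k + 1) - 1 / 2 :=
    sub_le_sub_right (one_div_le_one_div_of_le (hpar.lam_pos _) (hpar.lam_le _)) _
  have hKlam : 1 / lam (k + 1) + 2 ≤ K :=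
    add_le_add_left (one_div_le_one_div_of_le hpar.l_pos (hpar.l_le_lam _)) 2
  have hstep := hE.lyapunov_step_le hP (hpar.alpha_nonneg (k + 1)) (hpar.alpha_le_one (k + 1))
    (hpar.lam_pos (k + 1)) hc hclam hKlam (hit.mu_succ k) (hit.z_succ (k + 1))
  exact hstep.trans (by gcongr; exact hC _ _)

lemma summable_norm_sub_sq_of_monotone (hit : IsInertialIteration P α lam e z μ)
    (hP : IsFirmlyNonexpansive P) (hs : P s = s) (hpar : AdmissibleParameters α lam a l θ)
    (hmono : Monotone α) {σ δ : ℝ} (hσ : 0 < σ) (hδ : 0 < δ)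
    (hlam : ∀ k, (a + δ * (lam k / 2)) * (a * (1 + a) + a * δ + σ) ≤ (1 - lam k / 2) * δ)
    (hz : Bornology.IsBounded (Set.range z)) (he : Summable fun k => ‖e k‖) :
    Summable fun k => ‖z (k + 1) - z k‖ ^ 2 := by
  have ha := hpar.a_nonneg
  obtain ⟨C, hCs, hC⟩ := exists_norm_sub_le_of_isBounded hz s
  set Γ := a * (1 + a) + a * δ with hΓ
  have hbdd : BddBelow (Set.range fun k =>
      ‖z (k + 1) - s‖ ^ 2 - α (k + 1) * ‖z k - s‖ ^ 2 + Γ * ‖z (k + 1) - z k‖ ^ 2) := by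
    refine ⟨-C ^ 2, Set.forall_mem_range.mpr fun k => ?_⟩
    have hold : α (k + 1) * ‖z k - s‖ ^ 2 ≤ 1 * C ^ 2 := by
      gcongr
      exacts [hpar.alpha_le_one _, hCs k]
    have hΓ₀ : 0 ≤ Γ * ‖z (k + 1) - z k‖ ^ 2 := by positivity
    linarith [sq_nonneg ‖z (k + 1) - s‖]
  have hsum := summable_of_add_le_add hbdd (b := fun k => σ * ‖z (k + 2) - z (k + 1)‖ ^ 2)
    (s := fun k => 8 * C * ‖e (k + 1)‖) (fun k => by positivity)
    (((summable_nat_add_iff 1).mpr he).mul_left _) fun k => ?_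
  · exact (summable_nat_add_iff 1).mp ((summable_mul_left_iff hσ.ne').mp hsum)
  have hα := hpar.alpha_nonneg (k + 1)
  have hlam₀ := hpar.lam_pos (k + 1)
  have hlam₂ : lam (k + 1) ≤ 2 := (hpar.lam_le _).trans hpar.θ_lt_two.le
  have hstep := hP.inertial_energy_step_le hs hα (hpar.alpha_le (k + 1)) hlam₀ hlam₂ hσ.le hδ
    (hlam (k + 1)) (hit.mu_succ k) (hit.z_succ (k + 1))
  have herr := mul_le_mul_of_nonneg_right (energy_error_coeff_le hα (hpar.alpha_le_one _)
    hlam₀.le hlam₂ (hC (k + 1) k) (hC (k + 2) (k + 1)) (hCs (k + 2))) (norm_nonneg (e (k + 1)))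
  have hα_succ := mul_le_mul_of_nonneg_right (hmono (Nat.le_add_right (k + 1) 1))
    (sq_nonneg ‖z (k + 1) - s‖)
  rw [← hΓ] at hstep
  linarith

end IsInertialIteration

end InertialIteration

section StrongConvexity

variable {E : Type*} [NormedAddCommGroup E]

lemma add_sq_norm_le_of_isMinOn [NormedSpace ℝ E] {s : Set E} {m : ℝ} {g : E → ℝ}
    (hg : StrongConvexOn s m g) {p y : E} (hp : p ∈ s) (hmin : IsMinOn g s p) (hy : y ∈ s) :
    g p + m / 2 * ‖y - p‖ ^ 2 ≤ g y := by
  have hchord : ∀ t ∈ Set.Ioo (0 : ℝ) 1, g p + (1 - t) * (m / 2 * ‖y - p‖ ^ 2) ≤ g y := by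
    rintro t ⟨ht0, ht1⟩
    have h1t : 0 ≤ 1 - t := sub_nonneg.mpr ht1.le
    have hconv := hg.2 hy hp ht0.le h1t (add_sub_cancel t 1)
    have hle := isMinOn_iff.mp hmin _ (hg.1 hy hp ht0.le h1t (add_sub_cancel t 1))
    simp only [smul_eq_mul] at hconv
    refine le_of_mul_le_mul_left ?_ ht0
    linarith
  have hlim : Tendsto (fun t : ℝ => g p + (1 - t) * (m / 2 * ‖y - p‖ ^ 2)) (𝓝[>] 0)
      (𝓝 (g p + m / 2 * ‖y - p‖ ^ 2)) :=
    (Continuous.tendsto' (by fun_prop) _ _ (by simp)).mono_left nhdsWithin_le_nhds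
  exact le_of_tendsto hlim (eventually_of_mem (Ioo_mem_nhdsGT one_pos) hchord)

lemma cauchySeq_of_tendsto_lowerBound [NormedSpace ℝ E] {s : Set E} {m c : ℝ} {g : E → ℝ}
    (hm : 0 < m) (hg : StrongConvexOn s m g) (hc : ∀ y ∈ s, c ≤ g y) {x : ℕ → E}
    (hx : ∀ n, x n ∈ s) (hlim : Tendsto (fun n => g (x n)) atTop (𝓝 c)) : CauchySeq x := by
  have hmid : ∀ i j, m / 8 * ‖x i - x j‖ ^ 2 ≤ (g (x i) - c) / 2 + (g (x j) - c) / 2 := by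
    intro i j
    have hhalf : (0 : ℝ) ≤ 1 / 2 := by norm_num
    have hconv := hg.2 (hx i) (hx j) hhalf hhalf (add_halves 1)
    have hle := hc _ (hg.1 (hx i) (hx j) hhalf hhalf (add_halves 1))
    simp only [smul_eq_mul] at hconv
    linarith
  have hgap : Tendsto (fun n => (g (x n) - c) / 2) atTop (𝓝 0) := by
    simpa using (hlim.sub_const c).div_const 2
  have hsq : Tendsto (fun q : ℕ × ℕ => ‖x q.1 - x q.2‖ ^ 2) atTop (𝓝 0) := by
    rw [← prod_atTop_atTop_eq]
    have hsum := ((hgap.comp tendsto_fst).add (hgap.comp tendsto_snd)).const_mul (8 / m)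
    simp only [add_zero, mul_zero] at hsum
    refine squeeze_zero (fun q => sq_nonneg _) (fun q => ?_) hsum
    rw [div_mul_eq_mul_div, le_div_iff₀ hm]
    simp only [Function.comp_apply]
    linarith [hmid q.1 q.2]
  refine cauchySeq_iff_tendsto_dist_atTop_0.mpr ?_
  simpa only [Real.sqrt_sq (norm_nonneg _), Real.sqrt_zero, dist_eq_norm] using hsq.sqrt

lemma exists_isMinOn_of_strongConvexOn [NormedSpace ℝ E] [CompleteSpace E] {s : Set E} {m : ℝ}
    {g : E → ℝ} (hm : 0 < m) (hg : StrongConvexOn s m g) (hs : s.Nonempty)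
    (hbdd : BddBelow (g '' s)) (hclosed : IsClosed {q : E × ℝ | q.1 ∈ s ∧ g q.1 ≤ q.2}) :
    ∃ p ∈ s, IsMinOn g s p := by
  obtain ⟨v, -, hv, hvmem⟩ := exists_seq_tendsto_sInf (hs.image g) hbdd
  choose x hx hxv using hvmem
  obtain rfl : (fun n => g (x n)) = v := funext hxv
  have hc : ∀ y ∈ s, sInf (g '' s) ≤ g y := fun y hy => csInf_le hbdd ⟨y, hy, rfl⟩
  obtain ⟨p, hp⟩ := cauchySeq_tendsto_of_complete (cauchySeq_of_tendsto_lowerBound hm hg hc hx hv)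
  have hmem : p ∈ s ∧ g p ≤ sInf (g '' s) :=
    hclosed.mem_of_tendsto (hp.prodMk_nhds hv) (Eventually.of_forall fun n => ⟨hx n, le_rfl⟩)
  exact ⟨p, hmem.1, isMinOn_iff.mpr fun y hy => hmem.2.trans (hc y hy)⟩

lemma sub_mul_le_of_convexOn [NormedSpace ℝ E] {s : Set E} {φ : E → ℝ} (hφ : ConvexOn ℝ s φ)
    {x₀ x : E} {r ε : ℝ} (hr : 0 < r) (hx₀ : x₀ ∈ s)
    (hball : ∀ y ∈ s, ‖y - x₀‖ < r → φ x₀ - ε ≤ φ y) (hx : x ∈ s) :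
    φ x₀ - ε * (1 + ‖x - x₀‖ / r) ≤ φ x := by
  set d := ‖x - x₀‖ with hd
  have hd0 : 0 ≤ d := norm_nonneg _
  have hrd : 0 < r + d := by positivity
  have ht : 0 ≤ r / (r + d) := by positivity
  have ht' : 0 ≤ d / (r + d) := by positivity
  have hsum : r / (r + d) + d / (r + d) = 1 := by field_simp
  have hdist : ‖(r / (r + d)) • x + (d / (r + d)) • x₀ - x₀‖ < r := by
    have hdir : (r / (r + d)) • x + (d / (r + d)) • x₀ - x₀ = (r / (r + d)) • (x - x₀) := by
      rw [eq_sub_of_add_eq' hsum]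
      module
    rw [hdir, norm_smul, Real.norm_of_nonneg ht, ← hd, div_mul_eq_mul_div, div_lt_iff₀ hrd]
    nlinarith
  have hlow := hball _ (hφ.1 hx hx₀ ht ht' hsum) hdist
  have hconv := hφ.2 hx hx₀ ht ht' hsum
  simp only [smul_eq_mul] at hconv
  have hscale : (r / (r + d)) * (φ x₀ - ε * (1 + d / r)) = (1 - d / (r + d)) * φ x₀ - ε := by
    field_simp
    ring
  refine le_of_mul_le_mul_left ?_ (div_pos hr hrd)
  linarith

lemma strongConvexOn_half_sq_norm_sub_add [InnerProductSpace ℝ E] {s : Set E} {φ : E → ℝ}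
    (hφ : ConvexOn ℝ s φ) (u : E) :
    StrongConvexOn s 1 fun x => 1 / 2 * ‖x - u‖ ^ 2 + φ x := by
  rw [strongConvexOn_iff_convex]
  have haff : ConvexOn ℝ s fun x => ⟪-u, x⟫ + 1 / 2 * ‖u‖ ^ 2 :=
    (((innerSL ℝ (-u)).toLinearMap.convexOn hφ.1).add_const _)
  refine (haff.add hφ).congr fun x _ => ?_
  simp only [Pi.add_apply]
  rw [norm_sub_sq_real, inner_neg_left, real_inner_comm]
  ring

end StrongConvexity

section Prox

variable {H : Type*}

/-- The effective domain `dom f = {f < +∞}`; finiteness from below is a separate hypothesis. -/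
def effectiveDomain (f : H → EReal) : Set H :=
  {x | f x ≠ ⊤}

lemma mem_Argmin_iff {f : H → EReal} (hbot : ∀ x, f x ≠ ⊥) (hdom : (effectiveDomain f).Nonempty)
    {p : H} : p ∈ Argmin f ↔
      p ∈ effectiveDomain f ∧ IsMinOn (fun x => (f x).toReal) (effectiveDomain f) p := by
  constructor
  · intro hp
    obtain ⟨y, hy⟩ := hdom
    have hptop : f p ≠ ⊤ := ((hp y).trans_lt (lt_top_iff_ne_top.mpr hy)).ne
    exact ⟨hptop, isMinOn_iff.mpr fun x hx => EReal.toReal_le_toReal (hp x) (hbot p) hx⟩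
  · rintro ⟨hptop, hmin⟩ x
    by_cases hx : f x = ⊤
    · exact hx ▸ le_top
    · rw [← EReal.coe_toReal hptop (hbot p), ← EReal.coe_toReal hx (hbot x)]
      exact EReal.coe_le_coe_iff.mpr (isMinOn_iff.mp hmin x hx)

variable [NormedAddCommGroup H] [InnerProductSpace ℝ H] {f : H → EReal} {ρ : ℝ}

/-- `ρ` times the function minimized by `prox f ρ u`. On `effectiveDomain f` it is the true value;
elsewhere `EReal.toReal` returns a junk value. -/
noncomputable def proxObjective (f : H → EReal) (ρ : ℝ) (u x : H) : ℝ :=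
  1 / 2 * ‖x - u‖ ^ 2 + ρ * (f x).toReal

/-- `ρ` times the Moreau envelope of `f` with parameter `ρ`. -/
noncomputable def moreauEnvelope (f : H → EReal) (ρ : ℝ) (u : H) : ℝ :=
  proxObjective f ρ u (prox f ρ u)

lemma IsProperConvexLsc.convexOn_toReal (hf : IsProperConvexLsc f) :
    ConvexOn ℝ (effectiveDomain f) fun x => (f x).toReal := by
  have hle : ∀ x ∈ effectiveDomain f, ∀ y ∈ effectiveDomain f, ∀ a b : ℝ, 0 < a → 0 < b →
      a + b = 1 → f (a • x + b • y) ≤ ((a * (f x).toReal + b * (f y).toReal : ℝ) : EReal) := by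
    intro x hx y hy a b ha hb hab
    have hconv := hf.convex x y a b ha hb hab
    rwa [← EReal.coe_toReal hx (hf.ne_bot x), ← EReal.coe_toReal hy (hf.ne_bot y),
      ← EReal.coe_mul, ← EReal.coe_mul, ← EReal.coe_add] at hconv
  refine convexOn_iff_forall_pos.mpr ⟨convex_iff_forall_pos.mpr ?_, ?_⟩
  · intro x hx y hy a b ha hb hab
    exact ((hle x hx y hy a b ha hb hab).trans_lt (EReal.coe_lt_top _)).ne
  · intro x hx y hy a b ha hb hab
    exact EReal.toReal_le_toReal (hle x hx y hy a b ha hb hab) (hf.ne_bot _) (EReal.coe_ne_top _)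

lemma IsProperConvexLsc.strongConvexOn_proxObjective (hf : IsProperConvexLsc f) (hρ : 0 ≤ ρ)
    (u : H) : StrongConvexOn (effectiveDomain f) 1 (proxObjective f ρ u) :=
  strongConvexOn_half_sq_norm_sub_add (hf.convexOn_toReal.smul hρ) u

lemma IsProperConvexLsc.exists_sub_mul_norm_le (hf : IsProperConvexLsc f) :
    ∃ (x₀ : H) (b C : ℝ), ∀ x ∈ effectiveDomain f, b - C * ‖x - x₀‖ ≤ (f x).toReal := by
  obtain ⟨x₀, hx₀⟩ := hf.proper
  have hlt : (((f x₀).toReal - 1 : ℝ) : EReal) < f x₀ := by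
    conv_rhs => rw [← EReal.coe_toReal hx₀ (hf.ne_bot x₀)]
    exact EReal.coe_lt_coe_iff.mpr (sub_one_lt _)
  obtain ⟨r, hr, hball⟩ := Metric.eventually_nhds_iff.mp (hf.lsc x₀ _ hlt)
  refine ⟨x₀, (f x₀).toReal - 1, 1 / r, fun x hx => ?_⟩
  have hlow := sub_mul_le_of_convexOn hf.convexOn_toReal (ε := 1) hr hx₀ (fun y hy hyr => ?_) hx
  · linarith [one_div_mul_eq_div r ‖x - x₀‖]
  · rw [← EReal.coe_le_coe_iff, EReal.coe_toReal hy (hf.ne_bot y)]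
    exact (hball (by rwa [dist_eq_norm])).le

lemma IsProperConvexLsc.bddBelow_proxObjective (hf : IsProperConvexLsc f) (hρ : 0 ≤ ρ) (u : H) :
    BddBelow (proxObjective f ρ u '' effectiveDomain f) := by
  obtain ⟨x₀, b, C, hbC⟩ := hf.exists_sub_mul_norm_le
  refine ⟨ρ * (b - |C| * ‖u - x₀‖) - (ρ * |C|) ^ 2 / 2, ?_⟩
  rintro _ ⟨x, hx, rfl⟩
  have hC : C * ‖x - x₀‖ ≤ |C| * (‖x - u‖ + ‖u - x₀‖) :=
    mul_le_mul (le_abs_self C) (norm_sub_le_norm_sub_add_norm_sub x u x₀) (norm_nonneg _)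
      (abs_nonneg C)
  have hlow := mul_le_mul_of_nonneg_left ((sub_le_sub_left hC b).trans (hbC x hx)) hρ
  rw [proxObjective]
  linarith [sq_nonneg (‖x - u‖ - ρ * |C|)]

lemma IsProperConvexLsc.isClosed_epigraph_proxObjective (hf : IsProperConvexLsc f) (hρ : 0 < ρ)
    (u : H) :
    IsClosed {q : H × ℝ | q.1 ∈ effectiveDomain f ∧ proxObjective f ρ u q.1 ≤ q.2} := by
  have hcont : Continuous fun q : H × ℝ =>
      (q.1, (((q.2 - 1 / 2 * ‖q.1 - u‖ ^ 2) / ρ : ℝ) : EReal)) :=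
    continuous_fst.prodMk (continuous_coe_real_ereal.comp (by fun_prop))
  convert hf.lsc.isClosed_epigraph.preimage hcont using 1
  ext ⟨x, r⟩
  have hiff : proxObjective f ρ u x ≤ r ↔ (f x).toReal ≤ (r - 1 / 2 * ‖x - u‖ ^ 2) / ρ := by
    rw [proxObjective, le_div_iff₀' hρ, le_sub_iff_add_le']
  constructor
  · rintro ⟨hx, hle⟩
    change f x ≤ _
    rw [← EReal.coe_toReal hx (hf.ne_bot x)]
    exact EReal.coe_le_coe_iff.mpr (hiff.mp hle)
  · intro hle
    have hx : f x ≠ ⊤ := (lt_of_le_of_lt hle (EReal.coe_lt_top _)).ne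
    refine ⟨hx, hiff.mpr ?_⟩
    exact EReal.toReal_le_toReal hle (hf.ne_bot x) (EReal.coe_ne_top _)

lemma IsProperConvexLsc.mem_Argmin_iff_isMinOn_proxObjective (hf : IsProperConvexLsc f)
    (hρ : 0 < ρ) {u p : H} :
    p ∈ Argmin (fun x : H => ((1 / (2 * ρ) * ‖x - u‖ ^ 2 : ℝ) : EReal) + f x) ↔
      p ∈ effectiveDomain f ∧ IsMinOn (proxObjective f ρ u) (effectiveDomain f) p := by
  set F : H → EReal := fun x => ((1 / (2 * ρ) * ‖x - u‖ ^ 2 : ℝ) : EReal) + f x with hF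
  have hbot : ∀ x, F x ≠ ⊥ := fun x =>
    EReal.add_ne_bot_iff.mpr ⟨EReal.coe_ne_bot _, hf.ne_bot x⟩
  have hdom : effectiveDomain F = effectiveDomain f := by
    ext x
    exact (EReal.add_ne_top_iff_ne_top_right (EReal.coe_ne_bot _) (EReal.coe_ne_top _))
  have hscale : ∀ x ∈ effectiveDomain f, proxObjective f ρ u x = ρ * (F x).toReal := by
    intro x hx
    rw [hF, EReal.toReal_add (EReal.coe_ne_top _) (EReal.coe_ne_bot _) hx (hf.ne_bot x),
      EReal.toReal_coe, proxObjective]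
    field_simp
  rw [mem_Argmin_iff hbot (hdom ▸ hf.proper), hdom]
  refine and_congr_right fun hp => ?_
  simp only [isMinOn_iff]
  refine forall₂_congr fun x hx => ?_
  rw [hscale p hp, hscale x hx, mul_le_mul_iff_right₀ hρ]

section Complete

variable [CompleteSpace H]

lemma IsProperConvexLsc.isMinOn_prox (hf : IsProperConvexLsc f) (hρ : 0 < ρ) (u : H) :
    prox f ρ u ∈ effectiveDomain f ∧
      IsMinOn (proxObjective f ρ u) (effectiveDomain f) (prox f ρ u) := by
  obtain ⟨p, hp, hmin⟩ := exists_isMinOn_of_strongConvexOn one_pos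
    (hf.strongConvexOn_proxObjective hρ.le u) hf.proper (hf.bddBelow_proxObjective hρ.le u)
    (hf.isClosed_epigraph_proxObjective hρ u)
  refine (hf.mem_Argmin_iff_isMinOn_proxObjective hρ).mp (Classical.epsilon_spec ⟨p, ?_⟩)
  exact (hf.mem_Argmin_iff_isMinOn_proxObjective hρ).mpr ⟨hp, hmin⟩

lemma IsProperConvexLsc.add_inner_prox_le (hf : IsProperConvexLsc f) (hρ : 0 < ρ) (u : H) {y : H}
    (hy : y ∈ effectiveDomain f) :
    ρ * (f (prox f ρ u)).toReal + ⟪u - prox f ρ u, y - prox f ρ u⟫ ≤ ρ * (f y).toReal := by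
  obtain ⟨hp, hmin⟩ := hf.isMinOn_prox hρ u
  have hgrowth := add_sq_norm_le_of_isMinOn (hf.strongConvexOn_proxObjective hρ.le u) hp hmin hy
  have hsq : ‖y - u‖ ^ 2 = ‖y - prox f ρ u‖ ^ 2 - 2 * ⟪u - prox f ρ u, y - prox f ρ u⟫
      + ‖prox f ρ u - u‖ ^ 2 := by
    rw [← sub_sub_sub_cancel_right y u (prox f ρ u), norm_sub_sq_real, norm_sub_rev u,
      real_inner_comm]
  simp only [proxObjective] at hgrowth
  linarith

lemma IsProperConvexLsc.isFirmlyNonexpansive_prox (hf : IsProperConvexLsc f) (hρ : 0 < ρ) :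
    IsFirmlyNonexpansive (prox f ρ) := by
  intro x y
  have hx := hf.add_inner_prox_le hρ x (hf.isMinOn_prox hρ y).1
  have hy := hf.add_inner_prox_le hρ y (hf.isMinOn_prox hρ x).1
  have hsum : ⟪x - prox f ρ x, prox f ρ y - prox f ρ x⟫ + ⟪y - prox f ρ y, prox f ρ x - prox f ρ y⟫
      = ‖prox f ρ x - prox f ρ y‖ ^ 2 - ⟪prox f ρ x - prox f ρ y, x - y⟫ := by
    rw [← neg_sub (prox f ρ x) (prox f ρ y), inner_neg_right, ← sub_eq_neg_add, ← inner_sub_left,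
      real_inner_comm, ← real_inner_self_eq_norm_sq, ← inner_sub_right]
    congr 1
    abel
  linarith

lemma IsProperConvexLsc.mem_Argmin_iff_prox_eq (hf : IsProperConvexLsc f) (hρ : 0 < ρ) {s : H} :
    s ∈ Argmin f ↔ prox f ρ s = s := by
  obtain ⟨hp, hmin⟩ := hf.isMinOn_prox hρ s
  rw [mem_Argmin_iff hf.ne_bot hf.proper]
  constructor
  · rintro ⟨hs, hsmin⟩
    have hvar := hf.add_inner_prox_le hρ s hs
    have hle := mul_le_mul_of_nonneg_left (isMinOn_iff.mp hsmin _ hp) hρ.le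
    rw [real_inner_self_eq_norm_sq] at hvar
    have hzero : ‖s - prox f ρ s‖ ^ 2 = 0 := le_antisymm (by linarith) (sq_nonneg _)
    exact (norm_sub_eq_zero_iff.mp (pow_eq_zero_iff two_ne_zero |>.mp hzero)).symm
  · intro hs
    rw [hs] at hp
    refine ⟨hp, isMinOn_iff.mpr fun y hy => ?_⟩
    have hvar := hf.add_inner_prox_le hρ s hy
    rw [hs, sub_self, inner_zero_left, add_zero] at hvar
    exact le_of_mul_le_mul_left hvar hρ

lemma IsProperConvexLsc.isResidualPotential_moreauEnvelope (hf : IsProperConvexLsc f)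
    (hρ : 0 < ρ) : IsResidualPotential (prox f ρ) (moreauEnvelope f ρ) := by
  intro x m
  have htest := isMinOn_iff.mp (hf.isMinOn_prox hρ x).2 _ (hf.isMinOn_prox hρ m).1
  have hsq : ‖prox f ρ m - x‖ ^ 2 = ‖prox f ρ m - m‖ ^ 2 + 2 * ⟪m - prox f ρ m, x - m⟫
      + ‖x - m‖ ^ 2 := by
    rw [← sub_sub_sub_cancel_right _ x m, norm_sub_sq_real, ← neg_sub m (prox f ρ m),
      inner_neg_left]
    ring
  simp only [moreauEnvelope, proxObjective] at htest ⊢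
  linarith

lemma IsProperConvexLsc.mul_toReal_le_moreauEnvelope (hf : IsProperConvexLsc f) (hρ : 0 < ρ)
    {s : H} (hs : s ∈ Argmin f) (x : H) : ρ * (f s).toReal ≤ moreauEnvelope f ρ x := by
  have hsmin := ((mem_Argmin_iff hf.ne_bot hf.proper).mp hs).2
  have hle := isMinOn_iff.mp hsmin _ (hf.isMinOn_prox hρ x).1
  exact (mul_le_mul_of_nonneg_left hle hρ.le).trans (le_add_of_nonneg_left (by positivity))

end Complete

end Prox

section Conditions

variable {H : Type*} [NormedAddCommGroup H] [InnerProductSpace ℝ H] {α lam : ℕ → ℝ} {e z : ℕ → H}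
  {a l l' σ δ x : ℝ}

lemma le_lamBar_iff (ha : 0 ≤ a) (hσ : 0 < σ) (hδ : 0 < δ) :
    x ≤ lamBar a σ δ ↔ (a + δ * (x / 2)) * (a * (1 + a) + a * δ + σ) ≤ (1 - x / 2) * δ := by
  have hden : 0 < δ * (1 + a * (1 + a) + a * δ + σ) := by positivity
  rw [lamBar, ← div_le_iff₀' two_pos, le_div_iff₀ hden]
  constructor <;> intro h <;> linarith

lemma lamBar_lt_two (ha : 0 ≤ a) (hσ : 0 < σ) (hδ : 0 < δ) : lamBar a σ δ < 2 := by
  rw [← not_le, le_lamBar_iff ha hσ hδ, not_le, div_self two_ne_zero, sub_self, zero_mul]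
  positivity

lemma ConditionsI.admissibleParameters (h : ConditionsI α lam e z a l l') :
    AdmissibleParameters α lam a l l' :=
  ⟨fun k => (h.alpha_mem k).1, fun k => (h.alpha_mem k).2, h.a_lt_one, h.l_pos,
    fun k => (h.lam_mem k).1, fun k => (h.lam_mem k).2, h.l'_lt_two⟩

lemma ConditionsI.summable_norm_error (h : ConditionsI α lam e z a l l') :
    Summable fun k => ‖e k‖ :=
  (summable_mul_left_iff h.l_pos.ne').mp <| h.summable_error.of_nonneg_of_le
    (fun _ => mul_nonneg h.l_pos.le (norm_nonneg _))
    fun k => mul_le_mul_of_nonneg_right (h.lam_mem k).1 (norm_nonneg _)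

lemma ConditionsII.a_nonneg (h : ConditionsII α lam e z a l σ δ) : 0 ≤ a :=
  (h.alpha_mem 0).1.trans (h.alpha_mem 0).2

lemma ConditionsII.admissibleParameters (h : ConditionsII α lam e z a l σ δ) :
    AdmissibleParameters α lam a l (lamBar a σ δ) :=
  ⟨fun k => (h.alpha_mem k).1, fun k => (h.alpha_mem k).2, h.a_lt_one, h.l_pos,
    fun k => (h.lam_mem k).1, fun k => (h.lam_mem k).2, lamBar_lt_two h.a_nonneg h.σ_pos h.δ_pos⟩

variable {f : H → EReal} {ρ : ℝ} {zInit : H} {μ : ℕ → H}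

lemma IsGenerated.isInertialIteration (hgen : IsGenerated f ρ α lam e zInit z μ) :
    IsInertialIteration (prox f ρ) α lam e z μ :=
  ⟨hgen.mu_succ, hgen.z_succ⟩

variable [CompleteSpace H]

lemma ConditionsI.summable_norm_sub_sq (h : ConditionsI α lam e z a l l')
    (hit : IsInertialIteration (prox f ρ) α lam e z μ) (hf : IsProperConvexLsc f)
    (hΩ : (Argmin f).Nonempty) (hρ : 0 < ρ) : Summable fun k => ‖z (k + 1) - z k‖ ^ 2 := by
  obtain ⟨s, hs⟩ := hΩ
  have hbdd : BddBelow (Set.range (moreauEnvelope f ρ)) :=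
    ⟨_, Set.forall_mem_range.mpr (hf.mul_toReal_le_moreauEnvelope hρ hs)⟩
  exact hit.summable_norm_sub_sq_of_isResidualPotential
    (hf.isFirmlyNonexpansive_prox hρ).lipschitzWith (hf.isResidualPotential_moreauEnvelope hρ)
    hbdd h.admissibleParameters h.bounded h.summable_norm_error h.summable_inertia

lemma ConditionsII.summable_norm_sub_sq (h : ConditionsII α lam e z a l σ δ)
    (hit : IsInertialIteration (prox f ρ) α lam e z μ) (hf : IsProperConvexLsc f)
    (hΩ : (Argmin f).Nonempty) (hρ : 0 < ρ) : Summable fun k => ‖z (k + 1) - z k‖ ^ 2 := by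
  obtain ⟨s, hs⟩ := hΩ
  exact hit.summable_norm_sub_sq_of_monotone (hf.isFirmlyNonexpansive_prox hρ)
    ((hf.mem_Argmin_iff_prox_eq hρ).mp hs) h.admissibleParameters h.alpha_mono h.σ_pos h.δ_pos
    (fun k => (le_lamBar_iff h.a_nonneg h.σ_pos h.δ_pos).mp (h.lam_mem k).2) h.bounded
    h.summable_error

end Conditions

end InertialProx

open InertialProx

theorem corollary4p1 {H : Type*} [NormedAddCommGroup H] [InnerProductSpace ℝ H] [CompleteSpace H]
    (f : H → EReal) (hf : InertialProx.IsProperConvexLsc f)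
    (hΩ : (InertialProx.Argmin f).Nonempty)
    (ρ : ℝ) (hρ : 0 < ρ) (α lam : ℕ → ℝ) (e : ℕ → H) (zInit : H) (z μ : ℕ → H)
    (hgen : InertialProx.IsGenerated f ρ α lam e zInit z μ)
    (a l θ : ℝ)
    (hcond : (∃ l' : ℝ, InertialProx.ConditionsI α lam e z a l l' ∧ θ = l') ∨
      (∃ σ δ : ℝ, InertialProx.ConditionsII α lam e z a l σ δ ∧
        θ = InertialProx.lamBar a σ δ)) :
    (∀ zs ∈ InertialProx.Argmin f,
      ∃ d : ℝ, Filter.Tendsto (fun k => ‖z k - zs‖) Filter.atTop (nhds d)) ∧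
    (∃ zs ∈ InertialProx.Argmin f,
      Filter.Tendsto (fun k => toWeakSpace ℝ H (z k)) Filter.atTop
        (nhds (toWeakSpace ℝ H zs))) ∧
    (∀ zs ∈ InertialProx.Argmin f,
      Summable (InertialProx.incTerm z zs) ∧
      Summable (InertialProx.errTerm lam e z zs) ∧
      Summable (InertialProx.inertiaTerm α z) ∧
      ∀ (k : ℕ) (hk : 1 ≤ k),
        (Finset.Icc 1 k).inf' (Finset.nonempty_Icc.mpr hk)
            (fun i => ‖InertialProx.prox f ρ (μ i) - μ i‖ ^ 2) ≤
          1 / (k * l * (2 - θ)) *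
            (‖z 1 - zs‖ ^ 2 + InertialProx.Delta α lam e z a zs)) := by
  have hit := hgen.isInertialIteration
  have hP := hf.isFirmlyNonexpansive_prox hρ
  have hfix (s : H) : s ∈ Argmin f ↔ prox f ρ s = s := hf.mem_Argmin_iff_prox_eq hρ
  obtain ⟨hpar, hz, he, hstep⟩ : AdmissibleParameters α lam a l θ ∧
      Bornology.IsBounded (Set.range z) ∧ (Summable fun k => ‖e k‖) ∧
      Summable fun k => ‖z (k + 1) - z k‖ ^ 2 := by
    rcases hcond with ⟨l', h, rfl⟩ | ⟨σ, δ, h, rfl⟩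
    · exact ⟨h.admissibleParameters, h.bounded, h.summable_norm_error,
        h.summable_norm_sub_sq hit hf hΩ hρ⟩
    · exact ⟨h.admissibleParameters, h.bounded, h.summable_error,
        h.summable_norm_sub_sq hit hf hΩ hρ⟩
  have hinertia := hpar.summable_inertiaTerm hstep
  have herr := hpar.summable_errTerm hz he
  have hinc (s : H) (hs : s ∈ Argmin f) : Summable (incTerm z s) :=
    hit.summable_incTerm hP ((hfix s).mp hs) hpar (herr s) hinertia
  refine ⟨fun s hs => exists_tendsto_norm_sub (hinc s hs), ?_, fun s hs =>
    ⟨hinc s hs, herr s, hinertia, fun k hk =>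
      hit.inf'_residual_le hP ((hfix s).mp hs) hpar (herr s) hinertia hk⟩⟩
  simp only [hfix]
  exact hit.exists_tendsto_toWeakSpace hP (hΩ.imp fun s => (hfix s).mp) hpar hz he hstep
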